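/- For $n\ge 1$, a divisor $d$ of $n$ is called a unitary divisor of $n$, written $d\mid\mid n$, if $\gcd(d,n/d)=1$. The unitary cyclotomic polynomials $\Phi^*_n(x)\in\mathbb Z[x]$ are the polynomials uniquely determined by $$x^n-1=\prod_{d\mid\mid n}\Phi^*_d(x)\qquad(n=1,2,3,\ldots);$$ explicitly, $\Phi^*_n(x)=\prod_{d}\Phi_d(x)$, where $\Phi_d$ is the $d$-th cyclotomic polynomial and $d$ runs over the divisors of $n$ that have the same prime divisors as $n$. For a polynomial $f=\sum_{j=0}^{\deg f}c_jx^j$ of degree $\deg f$ with integer coefficients let $\mathcal C(f)=\{c_j:0\le j\le\deg f\}$ be the set of all its coefficients, let $-\mathcal C(f)=\{-c:c\in\mathcal C(f)\}$, and let $H(f)=\max_j|c_j|$. **Theorem.** Let $p,q,r,s\ge 3$ be four pairwise coprime prime powers. Then: 1. $\mathcal C(\Phi^*_{pqr})$ is a string of consecutive integers, that is, there are integers $a\le b$ with $\mathcal C(\Phi^*_{pqr})=\{a,a+1,\ldots,b\}$. 2. If $r,s>\max(p,q)$, then $$\mathcal C(\Phi^*_{pqr})=\begin{cases}\mathcal C(\Phi^*_{pqs})&\text{if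 } r\equiv s \pmod{pq},\\ -\mathcal C(\Phi^*_{pqs})&\text{if } r\equiv -s \pmod{pq}.\end{cases}$$ 3. If $r\equiv s\pmod{pq}$ or $r\equiv -s\pmod{pq}$, and $r>\max(p,q)>s$, then $$H(\Phi^*_{pqs})\le H(\Phi^*_{pqr})\le H(\Phi^*_{pqs})+1.$$ -/

import Mathlib

open Polynomial
open scoped Pointwise

/-- The unitary (block) divisors of `n`: the divisors `d` of `n` with `gcd(d, n/d) = 1`. -/
def unitaryDivisors (n : ℕ) : Finset ℕ :=
  n.divisors.filter (fun d => Nat.Coprime d (n / d))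

/-- The unitary cyclotomic polynomial `Φ*_n`: the product of the cyclotomic polynomials `Φ_d` over
the divisors `d` of `n` that have the same square-free kernel (i.e. the same prime divisors) as `n`.
The lemmas `prod_unitaryCyclotomic` and `eq_unitaryCyclotomic` below show that, for `n ≥ 1`, this is
the unique family of integer polynomials with `X ^ n - 1 = ∏ Φ*_d`, `d` running over the unitary
divisors of `n`, for all `n ≥ 1`. -/
noncomputable def unitaryCyclotomic (n : ℕ) : ℤ[X] :=
  ∏ d ∈ n.divisors.filter (fun d => d.primeFactors = n.primeFactors), cyclotomic d ℤ

/-- The set `C(f)` of all coefficients of `f` (from degree `0` up to the degree of `f`). -/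
def coeffSet (f : ℤ[X]) : Set ℤ := {c | ∃ j ≤ f.natDegree, f.coeff j = c}

/-- The height `H(f)`: the maximum of the absolute values of the coefficients of `f`. -/
noncomputable def height (f : ℤ[X]) : ℕ :=
  (Finset.range (f.natDegree + 1)).sup (fun j => (f.coeff j).natAbs)

/-- A string of consecutive integers: a set `{a, a + 1, …, b}` with `a ≤ b`. -/
def IsConsecutiveString (S : Set ℤ) : Prop := ∃ a b : ℤ, a ≤ b ∧ S = Set.Icc a b

theorem factorization_of_mem_unitaryDivisors {n d : ℕ} (hd : d ∈ unitaryDivisors n) {p : ℕ}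
    (hp : p ∈ d.primeFactors) : d.factorization p = n.factorization p := by
  simp only [unitaryDivisors, Finset.mem_filter, Nat.mem_divisors] at hd
  obtain ⟨⟨⟨m, rfl⟩, hn⟩, hc⟩ := hd
  have hd0 : 0 < d := Nat.pos_of_ne_zero (by rintro rfl; simp at hn)
  rw [Nat.mul_div_cancel_left _ hd0] at hc
  rw [Nat.factorization_eq_of_coprime_left hc (Nat.mem_primeFactors_iff_mem_primeFactorsList.1 hp)]

/-- The defining system of equations of the unitary cyclotomic polynomials. -/
theorem prod_unitaryCyclotomic {n : ℕ} (hn : 0 < n) :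
    ∏ d ∈ unitaryDivisors n, unitaryCyclotomic d = X ^ n - 1 := by
  classical
  rw [← prod_cyclotomic_eq_X_pow_sub_one hn ℤ]
  unfold unitaryCyclotomic
  rw [← Finset.prod_biUnion]
  · apply Finset.prod_congr _ (fun _ _ => rfl)
    ext e
    simp only [Finset.mem_biUnion, Finset.mem_filter, Nat.mem_divisors]
    constructor
    · rintro ⟨d, hd, ⟨hed, -⟩, -⟩
      simp only [unitaryDivisors, Finset.mem_filter, Nat.mem_divisors] at hd
      exact ⟨hed.trans hd.1.1, hn.ne'⟩
    · rintro ⟨hen, -⟩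
      have he0 : e ≠ 0 := by rintro rfl; exact hn.ne' (zero_dvd_iff.mp hen)
      have hsub : e.primeFactors ⊆ n.primeFactors := Nat.primeFactors_mono hen hn.ne'
      set g : ℕ → ℕ := fun p => p ^ n.factorization p with hg
      have hnprod : (∏ p ∈ n.primeFactors, g p) = n := Nat.prod_factorization_pow_eq_self hn.ne'
      set d := ∏ p ∈ e.primeFactors, g p with hd
      have hsplit : d * ∏ p ∈ n.primeFactors \ e.primeFactors, g p = n := by
        rw [mul_comm, Finset.prod_sdiff hsub, hnprod]
      have hd0 : d ≠ 0 := by intro h; rw [h, zero_mul] at hsplit; exact hn.ne hsplit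
      have hcop : Nat.Coprime d (∏ p ∈ n.primeFactors \ e.primeFactors, g p) := by
        refine Nat.Coprime.prod_left fun a ha => Nat.Coprime.prod_right fun b hb => ?_
        rw [Finset.mem_sdiff] at hb
        refine Nat.Coprime.pow _ _ ((Nat.coprime_primes (Nat.prime_of_mem_primeFactors ha)
          (Nat.prime_of_mem_primeFactors hb.1)).2 ?_)
        rintro rfl
        exact hb.2 ha
      have hed : e ∣ d := by
        rw [← Nat.prod_factorization_pow_eq_self he0]
        refine Finset.prod_dvd_prod_of_dvd _ _ fun p _ => ?_
        exact pow_dvd_pow _ ((Nat.factorization_le_iff_dvd he0 hn.ne').2 hen p)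
      refine ⟨d, ?_, ⟨hed, hd0⟩, ?_⟩
      · simp only [unitaryDivisors, Finset.mem_filter, Nat.mem_divisors]
        refine ⟨⟨⟨_, hsplit.symm⟩, hn.ne'⟩, ?_⟩
        rw [← hsplit, Nat.mul_div_cancel_left _ (Nat.pos_of_ne_zero hd0)]
        exact hcop
      · refine Finset.Subset.antisymm (Nat.primeFactors_mono hed hd0) fun p hp => ?_
        obtain ⟨hpp, hpd, -⟩ := Nat.mem_primeFactors.1 hp
        obtain ⟨a, ha, hpa⟩ := (hpp.prime.dvd_finsetProd_iff _).1 hpd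
        rw [(Nat.prime_dvd_prime_iff_eq hpp (Nat.prime_of_mem_primeFactors ha)).1
          (hpp.dvd_of_dvd_pow hpa)]
        exact ha
  · intro a ha b hb hab
    rw [Function.onFun, Finset.disjoint_left]
    intro e hea heb
    simp only [Finset.mem_filter, Nat.mem_divisors] at hea heb
    apply hab
    have hpf : a.primeFactors = b.primeFactors := hea.2.symm.trans heb.2
    refine Nat.eq_of_factorization_eq hea.1.2 heb.1.2 fun p => ?_
    by_cases hp : p ∈ a.primeFactors
    · rw [factorization_of_mem_unitaryDivisors ha hp,
        factorization_of_mem_unitaryDivisors hb (hpf ▸ hp)]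
    · have hp' : p ∉ b.primeFactors := hpf ▸ hp
      rw [← Nat.support_factorization, Finsupp.notMem_support_iff] at hp hp'
      rw [hp, hp']

/-- The system of equations determines the unitary cyclotomic polynomials. -/
theorem eq_unitaryCyclotomic (f : ℕ → ℤ[X])
    (hf : ∀ n : ℕ, 0 < n → ∏ d ∈ unitaryDivisors n, f d = X ^ n - 1) :
    ∀ n : ℕ, 0 < n → f n = unitaryCyclotomic n := by
  intro n
  induction n using Nat.strong_induction_on with
  | _ n ih =>
    intro hn
    have hmem : n ∈ unitaryDivisors n := by
      simp [unitaryDivisors, hn.ne', Nat.div_self hn]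
    have h1 := hf n hn
    have h2 := prod_unitaryCyclotomic hn
    rw [← Finset.mul_prod_erase _ _ hmem] at h1 h2
    have h3 : ∏ d ∈ (unitaryDivisors n).erase n, f d
        = ∏ d ∈ (unitaryDivisors n).erase n, unitaryCyclotomic d := by
      refine Finset.prod_congr rfl fun d hd => ?_
      simp only [unitaryDivisors, Finset.mem_erase, Finset.mem_filter, Nat.mem_divisors] at hd
      exact ih d (lt_of_le_of_ne (Nat.le_of_dvd hn hd.2.1.1) hd.1)
        (Nat.pos_of_dvd_of_pos hd.2.1.1 hn)
    rw [h3] at h1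
    have h0 : ∏ d ∈ (unitaryDivisors n).erase n, unitaryCyclotomic d ≠ 0 := by
      intro h
      rw [h, mul_zero] at h2
      exact X_pow_sub_C_ne_zero hn (1 : ℤ) (by rw [map_one]; exact h2.symm)
    exact mul_right_cancel₀ h0 (h1.trans h2.symm)

/-! By symmetry let p < q. Cancelling factors gives Φ*_{pqr}(X) = B(X^r) · W(X), where B(Y) =
(Y^{pq}-1)(Y-1)/((Y^p-1)(Y^q-1)) = ∑ b_m Y^m and W is the power series of
(X^p-1)(X^q-1)/((X^{pq}-1)(X-1)). The coefficients of W have period pq: 1 on [0,p), -1 on [q,p+q), 0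
on the rest of a period. Hence the n-th coefficient is S(k,c) = ∑_{m<k} b_m W(c-rm) at c = n, k =
n/r+1 (`coeff_eq_truncSum`). For free k and c, S depends only on r mod pq, and r ↦ -r negates it
after a reflection of c (`windowSum_neg`).

The true coefficients are the S(k+1,c) with (c-rk) mod pq < r (`exists_coeff_eq_windowSum`). The
other values are controlled because the partial sums σ_k of the b_m lie in {0,1}, i.e. the nonzero
b_m alternate in sign (`truncSum_one_mem`). If r > q, each S lies between the extreme coefficients
(`windowSum_mem_Icc`), so the coefficient set is exactly the set of values of S; this gives claim 2.
If s < q, each S is within 1 of 0 or of a true coefficient (`exists_abs_windowSum_sub_le`); this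
gives claim 3.

For claim 1, adjacent coefficients differ by at most 1: W(u)-W(u-1) factors into a condition mod q
times one mod p, which leaves an alternating sum over four corners of a rectangle in the expansion
of B (`abs_sub_le_one_of_eq_windowSum`). -/

/-! ### Unitary divisors and the closed form for three prime powers -/

theorem mem_unitaryDivisors {n d : ℕ} (hn : n ≠ 0) :
    d ∈ unitaryDivisors n ↔ ∃ e, d * e = n ∧ Nat.Coprime d e := by
  simp only [unitaryDivisors, Finset.mem_filter, Nat.mem_divisors]
  constructor
  · rintro ⟨⟨hd, -⟩, hc⟩
    exact ⟨n / d, Nat.mul_div_cancel' hd, hc⟩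
  · rintro ⟨e, rfl, hc⟩
    have hd : 0 < d := Nat.pos_of_ne_zero (left_ne_zero_of_mul hn)
    exact ⟨⟨dvd_mul_right _ _, hn⟩, by rwa [Nat.mul_div_cancel_left _ hd]⟩

theorem prod_unitaryDivisors_mul {M : Type*} [CommMonoid M] {m n : ℕ} (hm : m ≠ 0) (hn : n ≠ 0)
    (h : Nat.Coprime m n) (f : ℕ → M) :
    ∏ d ∈ unitaryDivisors (m * n), f d =
      ∏ a ∈ unitaryDivisors m, ∏ b ∈ unitaryDivisors n, f (a * b) := by
  rw [← Finset.prod_product']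
  symm
  refine Finset.prod_bij' (fun x _ => x.1 * x.2) (fun d _ => (d.gcd m, d.gcd n)) ?_ ?_ ?_ ?_ ?_
  · rintro ⟨a, b⟩ hab
    simp only [Finset.mem_product, mem_unitaryDivisors hm, mem_unitaryDivisors hn] at hab
    obtain ⟨⟨a', rfl, ha⟩, ⟨b', rfl, hb⟩⟩ := hab
    rw [mem_unitaryDivisors (mul_ne_zero hm hn)]
    refine ⟨a' * b', by ring, ?_⟩
    simp only [Nat.coprime_mul_iff_left, Nat.coprime_mul_iff_right] at h ⊢
    exact ⟨⟨ha, h.1.2.symm⟩, ⟨h.2.1, hb⟩⟩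
  · intro d hd
    rw [mem_unitaryDivisors (mul_ne_zero hm hn)] at hd
    obtain ⟨e, he, hc⟩ := hd
    simp only [Finset.mem_product, mem_unitaryDivisors hm, mem_unitaryDivisors hn]
    refine ⟨⟨e.gcd m, ?_, (hc.coprime_dvd_left (Nat.gcd_dvd_left _ _)).coprime_dvd_right
      (Nat.gcd_dvd_left _ _)⟩, ⟨e.gcd n, ?_, (hc.coprime_dvd_left
      (Nat.gcd_dvd_left _ _)).coprime_dvd_right (Nat.gcd_dvd_left _ _)⟩⟩
    · rw [Nat.gcd_comm d, Nat.gcd_comm e, ← hc.gcd_mul, he, Nat.gcd_mul_right_right]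
    · rw [Nat.gcd_comm d, Nat.gcd_comm e, ← hc.gcd_mul, he, Nat.gcd_mul_left_right]
  · rintro ⟨a, b⟩ hab
    simp only [Finset.mem_product, mem_unitaryDivisors hm, mem_unitaryDivisors hn] at hab
    obtain ⟨⟨a', rfl, ha⟩, ⟨b', rfl, hb⟩⟩ := hab
    simp only [Nat.coprime_mul_iff_left, Nat.coprime_mul_iff_right] at h
    have h1 : Nat.Coprime b (a * a') := Nat.Coprime.mul_right h.1.1.symm h.1.2.symm
    have h2 : Nat.Coprime a (b * b') := Nat.Coprime.mul_right h.1.1 h.2.1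
    simp only [Prod.mk.injEq]
    exact ⟨by rw [h1.gcd_mul_right_cancel, Nat.gcd_mul_right_right],
      by rw [h2.gcd_mul_left_cancel, Nat.gcd_mul_right_right]⟩
  · intro d hd
    rw [mem_unitaryDivisors (mul_ne_zero hm hn)] at hd
    obtain ⟨e, he, hc⟩ := hd
    simp only
    rw [← h.gcd_mul, ← he, Nat.gcd_mul_right_right]
  · intros; rfl

theorem unitaryDivisors_of_isPrimePow {p : ℕ} (hp : IsPrimePow p) :
    unitaryDivisors p = {1, p} := by
  obtain ⟨π, k, hπ, hk, rfl⟩ := hp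
  have hπ' := hπ.nat_prime
  ext d
  rw [mem_unitaryDivisors (pow_ne_zero _ hπ'.ne_zero)]
  simp only [Finset.mem_insert, Finset.mem_singleton]
  constructor
  · rintro ⟨e, he, hc⟩
    obtain ⟨a, -, rfl⟩ := (Nat.dvd_prime_pow hπ').1 ⟨e, he.symm⟩
    rcases Nat.eq_zero_or_pos a with rfl | ha
    · left; simp
    · right
      have h1 : Nat.Coprime π e := hc.coprime_dvd_left (dvd_pow_self _ ha.ne')
      have h2 : e ∣ π ^ k := ⟨π ^ a, by rw [← he, mul_comm]⟩
      have h3 : e = 1 := Nat.Coprime.eq_one_of_dvd (h1.symm.pow_right k) h2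
      rw [← he, h3, mul_one]
  · rintro (rfl | rfl)
    · exact ⟨_, one_mul _, Nat.coprime_one_left _⟩
    · exact ⟨1, mul_one _, Nat.coprime_one_right _⟩

theorem unitaryCyclotomic_mul_mul {p q r : ℕ}
    (hp : IsPrimePow p) (hq : IsPrimePow q) (hr : IsPrimePow r)
    (hpq : Nat.Coprime p q) (hpr : Nat.Coprime p r) (hqr : Nat.Coprime q r) :
    unitaryCyclotomic (p * q * r) *
        ((X ^ (p * q) - 1) * (X ^ (p * r) - 1) * (X ^ (q * r) - 1) * (X - 1)) =
      (X ^ (p * q * r) - 1) * (X ^ p - 1) * (X ^ q - 1) * (X ^ r - 1) := by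
  have prod1 : ∀ {p : ℕ} (f : ℕ → ℤ[X]), IsPrimePow p →
      ∏ d ∈ unitaryDivisors p, f d = f 1 * f p := by
    intro p f hp
    rw [unitaryDivisors_of_isPrimePow hp, Finset.prod_pair hp.ne_one.symm]
  have hp0 := hp.pos; have hq0 := hq.pos; have hr0 := hr.pos
  have hpq0 := Nat.mul_pos hp0 hq0
  have e1 : (X : ℤ[X]) - 1 = unitaryCyclotomic 1 := by
    have := prod_unitaryCyclotomic one_pos
    simpa [show unitaryDivisors 1 = {1} by decide] using this.symm
  rw [e1, ← prod_unitaryCyclotomic (Nat.mul_pos hpq0 hr0), ← prod_unitaryCyclotomic hpq0,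
    ← prod_unitaryCyclotomic (Nat.mul_pos hp0 hr0), ← prod_unitaryCyclotomic (Nat.mul_pos hq0 hr0),
    ← prod_unitaryCyclotomic hp0, ← prod_unitaryCyclotomic hq0, ← prod_unitaryCyclotomic hr0,
    prod_unitaryDivisors_mul hpq0.ne' hr0.ne' (hpr.mul_left hqr),
    prod_unitaryDivisors_mul hp0.ne' hq0.ne' hpq, prod_unitaryDivisors_mul hp0.ne' hq0.ne' hpq,
    prod_unitaryDivisors_mul hp0.ne' hr0.ne' hpr, prod_unitaryDivisors_mul hq0.ne' hr0.ne' hqr]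
  simp only [prod1 _ hp, prod1 _ hq, prod1 _ hr, one_mul, mul_one]
  ring

/-! ### Heights and strings of consecutive integers -/

theorem natAbs_coeff_le_height (f : ℤ[X]) (n : ℕ) : (f.coeff n).natAbs ≤ height f := by
  by_cases h : n ≤ f.natDegree
  · exact Finset.le_sup (f := fun j => (f.coeff j).natAbs)
      (Finset.mem_range.2 (Nat.lt_succ_of_le h))
  · simp [coeff_eq_zero_of_natDegree_lt (not_le.1 h)]

theorem height_le {f : ℤ[X]} {b : ℕ} (h : ∀ n, (f.coeff n).natAbs ≤ b) : height f ≤ b :=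
  Finset.sup_le fun n _ => h n

/-- Discrete intermediate value theorem: a sequence with steps at most 1 that misses v stays on the
same side of v as f 0. -/
theorem exists_eq_of_natAbs_sub_le_one {f : ℕ → ℤ} (hf : ∀ n, |f (n + 1) - f n| ≤ 1) {N m n : ℕ}
    (hm : m ≤ N) (hn : n ≤ N) {v : ℤ} (hmv : f m ≤ v) (hvn : v ≤ f n) : ∃ k ≤ N, f k = v := by
  by_contra! hk
  have key : ∀ k ≤ N, (f k < v ↔ f 0 < v) := by
    intro k
    induction k with
    | zero => simp
    | succ k ih =>
      intro hkN
      have h1 := ih (by omega)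
      have h2 := hk k (by omega)
      have h3 := hk (k + 1) hkN
      have h4 := abs_le.1 (hf k)
      omega
  have h1 := key m hm
  have h2 := key n hn
  have h3 := hk m hm
  omega

theorem isConsecutiveString_coeffSet {f : ℤ[X]} (hf : ∀ n, |f.coeff (n + 1) - f.coeff n| ≤ 1) :
    IsConsecutiveString (coeffSet f) := by
  obtain ⟨m, hm, hmin⟩ := Finset.exists_min_image (Finset.range (f.natDegree + 1)) f.coeff
    ⟨0, by simp⟩
  obtain ⟨n, hn, hmax⟩ := Finset.exists_max_image (Finset.range (f.natDegree + 1)) f.coeff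
    ⟨0, by simp⟩
  refine ⟨f.coeff m, f.coeff n, hmin n hn, ?_⟩
  simp only [Finset.mem_range, Nat.lt_succ_iff] at hm hn hmin hmax
  ext v
  constructor
  · rintro ⟨j, hj, rfl⟩
    exact ⟨hmin j hj, hmax j hj⟩
  · rintro ⟨h1, h2⟩
    exact exists_eq_of_natAbs_sub_le_one hf hm hn h1 h2

/-! ### The factorization B(X^r) · W(X) -/

/-- The coefficients of the product expansion of the binary polynomial
`(Y ^ (p * q) - 1) * (Y - 1) / ((Y ^ p - 1) * (Y ^ q - 1))`. -/
def blockWeight (μ l i j : ℕ) : ℤ := (if i < μ then 1 else 0) + (if j < l then 1 else 0) - 1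

/-- The exponents of the product expansion of the binary polynomial
`(Y ^ (p * q) - 1) * (Y - 1) / ((Y ^ p - 1) * (Y ^ q - 1))`. -/
def blockExp (p q μ l i j : ℕ) : ℕ :=
  if μ ≤ i ∧ l ≤ j then i * p + j * q - p * q else i * p + j * q

/-- For `φ` the linear functional with `φ (Y ^ m) = h m`, the value of `φ` at the truncation below
degree `k` of `(Y ^ (p * q) - 1) * (Y - 1) / ((Y ^ p - 1) * (Y ^ q - 1))`. -/
def truncSum (p q μ l k : ℕ) (h : ℕ → ℤ) : ℤ :=
  ∑ i ∈ Finset.range q, ∑ j ∈ Finset.range p,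
    blockWeight μ l i j * if blockExp p q μ l i j < k then h (blockExp p q μ l i j) else 0

/-- The coefficients of the periodic power series
`(1 - X ^ p) * (1 - X ^ q) / ((1 - X) * (1 - X ^ (p * q)))`, for `p < q`. -/
def window (p q : ℕ) (u : ℤ) : ℤ :=
  (if u % (p * q : ℕ) < p then 1 else 0) -
    (if (q : ℤ) ≤ u % (p * q : ℕ) ∧ u % (p * q : ℕ) < p + q then 1 else 0)

theorem exists_mul_add_mul_eq {p q : ℕ} (hp : 2 ≤ p) (hq : 2 ≤ q) (h : Nat.Coprime p q) :
    ∃ μ l, μ < q ∧ l < p ∧ μ * p + l * q = p * q + 1 := by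
  obtain ⟨m, -, hm⟩ := Nat.exists_mul_mod_eq_one_of_coprime h (by omega)
  have h1 : p * (m % q) % q = 1 := by rw [Nat.mul_mod, Nat.mod_mod, ← Nat.mul_mod, hm]
  have hμ : m % q < q := Nat.mod_lt _ (by omega)
  generalize m % q = μ at h1 hμ
  have hμ0 : 0 < μ := by
    rcases Nat.eq_zero_or_pos μ with rfl | h
    · simp at h1
    · exact h
  have hle : p * μ + p ≤ p * q := by
    rw [← Nat.mul_succ]; exact Nat.mul_le_mul_left _ hμ
  have hdiv := Nat.div_add_mod (p * μ) q
  rw [h1] at hdiv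
  set t := p * μ / q with ht
  have htp : t < p := by
    by_contra! hc
    have := Nat.mul_le_mul_left q hc
    rw [mul_comm q p] at this
    omega
  have htpos : 0 < t := by
    rcases Nat.eq_zero_or_pos t with h0 | h0
    · rw [h0] at hdiv
      have := Nat.mul_le_mul_left p hμ0
      omega
    · exact h0
  -- With μ the inverse of p mod q, pμ = qt + 1, so l = p - t.
  refine ⟨μ, p - t, hμ, by omega, ?_⟩
  have : (p - t) * q + t * q = p * q := by rw [← Nat.add_mul]; congr 1; omega
  rw [mul_comm μ p]
  rw [mul_comm t q] at this
  omega

/-- Only two blocks of the q × p grid carry weight: +1 on i < μ, j < l and -1 on i ≥ μ, j ≥ l. Each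
is a product of two geometric sums. -/
theorem sum_blockWeight_mul_pow {R : Type*} [CommRing R] {p q μ l : ℕ} (hμ : μ < q) (hl : l < p)
    (h : μ * p + l * q = p * q + 1) (Y : R) :
    (∑ i ∈ Finset.range q, ∑ j ∈ Finset.range p,
        (blockWeight μ l i j : R) * Y ^ blockExp p q μ l i j) * ((Y ^ p - 1) * (Y ^ q - 1)) =
      (Y ^ (p * q) - 1) * (Y - 1) := by
  have key : (∑ i ∈ Finset.range q, ∑ j ∈ Finset.range p,
        (blockWeight μ l i j : R) * Y ^ blockExp p q μ l i j) =
      (∑ i ∈ Finset.range μ, (Y ^ p) ^ i) * (∑ j ∈ Finset.range l, (Y ^ q) ^ j) -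
      Y * ((∑ i ∈ Finset.range (q - μ), (Y ^ p) ^ i) *
        (∑ j ∈ Finset.range (p - l), (Y ^ q) ^ j)) := by
    have e1 : Finset.range q = Finset.range (μ + (q - μ)) := by congr 1; omega
    have e2 : Finset.range p = Finset.range (l + (p - l)) := by congr 1; omega
    rw [e1, e2]
    simp only [Finset.sum_range_add, Finset.sum_add_distrib]
    have z1 : ∀ i ∈ Finset.range μ, ∀ j ∈ Finset.range l,
        (blockWeight μ l i j : R) * Y ^ blockExp p q μ l i j = (Y ^ p) ^ i * (Y ^ q) ^ j := by
      intro i hi j hj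
      rw [Finset.mem_range] at hi hj
      rw [blockWeight, blockExp, if_pos hi, if_pos hj, if_neg (by omega), ← pow_mul, ← pow_mul,
        ← pow_add, mul_comm p, mul_comm q]
      simp
    have z2 : ∀ i ∈ Finset.range μ, ∀ j ∈ Finset.range (p - l),
        (blockWeight μ l i (l + j) : R) * Y ^ blockExp p q μ l i (l + j) = 0 := by
      intro i hi j hj
      rw [Finset.mem_range] at hi hj
      rw [blockWeight, if_pos hi, if_neg (by omega)]
      simp
    have z3 : ∀ i ∈ Finset.range (q - μ), ∀ j ∈ Finset.range l,
        (blockWeight μ l (μ + i) j : R) * Y ^ blockExp p q μ l (μ + i) j = 0 := by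
      intro i hi j hj
      rw [Finset.mem_range] at hi hj
      rw [blockWeight, if_neg (by omega), if_pos hj]
      simp
    have z4 : ∀ i ∈ Finset.range (q - μ), ∀ j ∈ Finset.range (p - l),
        (blockWeight μ l (μ + i) (l + j) : R) * Y ^ blockExp p q μ l (μ + i) (l + j) =
          - (Y * ((Y ^ p) ^ i * (Y ^ q) ^ j)) := by
      intro i hi j hj
      -- Since μp + lq = pq + 1, the corner of the negative block has exponent 1; this is the factor
      -- Y in `key`.
      have : (μ + i) * p + (l + j) * q - p * q = 1 + (p * i + q * j) := by
        have : (μ + i) * p + (l + j) * q = p * q + (1 + (p * i + q * j)) := by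
          linear_combination h
        omega
      rw [blockWeight, blockExp, if_neg (by omega), if_neg (by omega), if_pos (by omega), this,
        ← pow_mul, ← pow_mul, ← pow_add, pow_add, pow_one]
      simp
    rw [Finset.sum_congr rfl fun i hi => Finset.sum_congr rfl (z1 i hi),
      Finset.sum_congr rfl fun i hi => Finset.sum_congr rfl (z2 i hi),
      Finset.sum_congr rfl fun i hi => Finset.sum_congr rfl (z3 i hi),
      Finset.sum_congr rfl fun i hi => Finset.sum_congr rfl (z4 i hi)]
    simp only [Finset.sum_const_zero, add_zero, zero_add, Finset.sum_neg_distrib,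
      ← Finset.mul_sum, ← Finset.sum_mul, sub_eq_add_neg]
  have g1 := geom_sum_mul (Y ^ p) μ
  have g2 := geom_sum_mul (Y ^ q) l
  have g3 := geom_sum_mul (Y ^ p) (q - μ)
  have g4 := geom_sum_mul (Y ^ q) (p - l)
  rw [key]
  have e3 : (q - μ) * p + μ * p = p * q := by
    rw [← Nat.add_mul, Nat.sub_add_cancel hμ.le, mul_comm]
  have e4 : (p - l) * q + l * q = p * q := by
    rw [← Nat.add_mul, Nat.sub_add_cancel hl.le]
  -- In terms of a and b: μp = a + 1, lq = b + 1 and pq = a + b + 1.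
  obtain ⟨a, ha⟩ : ∃ a, (p - l) * q = a := ⟨_, rfl⟩
  obtain ⟨b, hb⟩ : ∃ b, (q - μ) * p = b := ⟨_, rfl⟩
  rw [← pow_mul, mul_comm p, show μ * p = a + 1 by omega, pow_succ] at g1
  rw [← pow_mul, mul_comm q, show l * q = b + 1 by omega, pow_succ] at g2
  rw [← pow_mul, mul_comm p, hb] at g3
  rw [← pow_mul, mul_comm q, ha] at g4
  rw [show p * q = a + b + 1 by omega, pow_succ, pow_add]
  calc _ = ((∑ i ∈ Finset.range μ, (Y ^ p) ^ i) * (Y ^ p - 1)) *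
        ((∑ j ∈ Finset.range l, (Y ^ q) ^ j) * (Y ^ q - 1)) -
        Y * (((∑ i ∈ Finset.range (q - μ), (Y ^ p) ^ i) * (Y ^ p - 1)) *
        ((∑ j ∈ Finset.range (p - l), (Y ^ q) ^ j) * (Y ^ q - 1))) := by ring
    _ = _ := by rw [g1, g2, g3, g4]; ring

open scoped PowerSeries in
theorem PowerSeries.X_pow_sub_one_ne_zero {m : ℕ} (hm : 0 < m) :
    (PowerSeries.X : ℤ⟦X⟧) ^ m - 1 ≠ 0 := by
  intro h0
  have := congrArg PowerSeries.constantCoeff h0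
  simp [hm.ne'] at this

open scoped PowerSeries in
theorem mk_window_mul {p q : ℕ} (hpq : p < q) (hN : p + q < p * q) :
    (PowerSeries.mk fun n => window p q n) * ((PowerSeries.X ^ (p * q) - 1) * (PowerSeries.X - 1)) =
      ((PowerSeries.X ^ p - 1) * (PowerSeries.X ^ q - 1) : ℤ⟦X⟧) := by
  have h1 : (PowerSeries.mk fun n => window p q n) * (1 - PowerSeries.X ^ (p * q)) =
      (∑ i ∈ Finset.range p, (PowerSeries.X : ℤ⟦X⟧) ^ i) * (1 - PowerSeries.X ^ q) := by
    ext n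
    have e : ∀ n, PowerSeries.coeff n (∑ i ∈ Finset.range p, (PowerSeries.X : ℤ⟦X⟧) ^ i) = if n < p then 1 else 0 := by
      intro n
      simp [map_sum, PowerSeries.coeff_X_pow]
    simp only [mul_sub, mul_one, map_sub, PowerSeries.coeff_mul_X_pow', PowerSeries.coeff_mk, e]
    unfold window
    by_cases hn : p * q ≤ n
    · have : ((n - p * q : ℕ) : ℤ) % (p * q : ℕ) = (n : ℤ) % (p * q : ℕ) := by
        rw [Nat.cast_sub hn, Int.sub_emod_right]
      rw [if_pos hn, this, if_neg (show ¬ n < p by omega), if_pos (show q ≤ n by omega),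
        if_neg (show ¬ n - q < p by omega)]
      ring
    · rw [if_neg hn, Int.emod_eq_of_lt (by omega) (by omega)]
      split_ifs <;> omega
  have h2 := geom_sum_mul (PowerSeries.X : ℤ⟦X⟧) p
  linear_combination (1 - PowerSeries.X) * h1 + (PowerSeries.X ^ q - 1) * h2

open scoped PowerSeries in
/-- The coefficients of a ternary inclusion-exclusion polynomial. -/
theorem coeff_eq_truncSum {p q r μ l : ℕ} (hμ : μ < q) (hl : l < p)
    (h : μ * p + l * q = p * q + 1) (hpq : p < q) (hN : p + q < p * q) (hr : 0 < r) {P : ℤ[X]}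
    (hP : P * ((Polynomial.X ^ (p * q) - 1) * (Polynomial.X ^ (p * r) - 1) *
        (Polynomial.X ^ (q * r) - 1) * (Polynomial.X - 1)) =
      (Polynomial.X ^ (p * q * r) - 1) * (Polynomial.X ^ p - 1) * (Polynomial.X ^ q - 1) *
        (Polynomial.X ^ r - 1)) (n : ℕ) :
    P.coeff n = truncSum p q μ l (n / r + 1) (fun m => window p q (n - r * m)) := by
  have hP' := congrArg (fun f : ℤ[X] => (f : ℤ⟦X⟧)) hP
  simp only [Polynomial.coe_mul, Polynomial.coe_sub, Polynomial.coe_pow, Polynomial.coe_X,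
    Polynomial.coe_one] at hP'
  have hB := sum_blockWeight_mul_pow hμ hl h ((PowerSeries.X : ℤ⟦X⟧) ^ r)
  have hW := mk_window_mul hpq hN
  set B := ∑ i ∈ Finset.range q, ∑ j ∈ Finset.range p,
    (blockWeight μ l i j : ℤ⟦X⟧) * ((PowerSeries.X : ℤ⟦X⟧) ^ r) ^ blockExp p q μ l i j with hBdef
  set W : ℤ⟦X⟧ := PowerSeries.mk fun n => window p q n with hWdef
  have ne := @PowerSeries.X_pow_sub_one_ne_zero
  have ne1 : (PowerSeries.X : ℤ⟦X⟧) - 1 ≠ 0 := by simpa using ne one_pos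
  have hp0 : 0 < p := by omega
  have hq0 : 0 < q := by omega
  -- Here B is already evaluated at X^r.
  have hPB : (P : ℤ⟦X⟧) = B * W := by
    have hne : ((PowerSeries.X : ℤ⟦X⟧) ^ (p * q) - 1) * (PowerSeries.X ^ (p * r) - 1) * (PowerSeries.X ^ (q * r) - 1) * (PowerSeries.X - 1) ≠ 0 :=
      mul_ne_zero (mul_ne_zero (mul_ne_zero (ne (by positivity)) (ne (by positivity)))
        (ne (by positivity))) ne1
    refine mul_right_cancel₀ hne ?_
    rw [hP']
    simp only [← pow_mul] at hB
    rw [mul_comm r p, mul_comm r q, mul_comm r] at hB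
    linear_combination -(PowerSeries.X ^ p - 1) * (PowerSeries.X ^ q - 1) * hB -
      B * (PowerSeries.X ^ (p * r) - 1) * (PowerSeries.X ^ (q * r) - 1) * hW
  rw [← Polynomial.coeff_coe, hPB, hBdef, Finset.sum_mul, map_sum, truncSum]
  refine Finset.sum_congr rfl fun i _ => ?_
  rw [Finset.sum_mul, map_sum]
  refine Finset.sum_congr rfl fun j _ => ?_
  generalize blockExp p q μ l i j = e
  rw [mul_assoc, ← pow_mul, ← map_intCast (PowerSeries.C (R := ℤ)), PowerSeries.coeff_C_mul, PowerSeries.coeff_X_pow_mul', hWdef,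
    Int.cast_id]
  have hlt : e < n / r + 1 ↔ r * e ≤ n := by
    rw [Nat.lt_succ_iff, Nat.le_div_iff_mul_le hr, mul_comm e r]
  by_cases h1 : r * e ≤ n
  · rw [if_pos h1, if_pos (hlt.2 h1), PowerSeries.coeff_mk, Nat.cast_sub h1, Nat.cast_mul]
  · rw [if_neg h1, if_neg (mt hlt.1 h1)]

/-- The coefficient b_k is expressed as σ_{k+1} - σ_k, with σ the truncated sum for h = 1, so that
bounds on σ control every increment. -/
theorem truncSum_succ (p q μ l k : ℕ) (h : ℕ → ℤ) :
    truncSum p q μ l (k + 1) h = truncSum p q μ l k h +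
      (truncSum p q μ l (k + 1) (fun _ => 1) - truncSum p q μ l k (fun _ => 1)) * h k := by
  simp only [truncSum, ← Finset.sum_sub_distrib, Finset.sum_mul, ← Finset.sum_add_distrib]
  refine Finset.sum_congr rfl fun i _ => Finset.sum_congr rfl fun j _ => ?_
  generalize blockExp p q μ l i j = e
  rcases lt_trichotomy e k with h1 | rfl | h1
  · rw [if_pos (by omega), if_pos (by omega), if_pos (by omega), if_pos h1]; ring
  · simp
  · rw [if_neg (by omega), if_neg (by omega), if_neg (by omega), if_neg (by omega)]; ring

theorem truncSum_zero (p q μ l : ℕ) (h : ℕ → ℤ) : truncSum p q μ l 0 h = 0 := by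
  simp [truncSum]

open scoped PowerSeries in
-- The partial sums of B are the coefficients of B/(1-Y) = (∑_{j<p} Y^{qj})/(1-Y^p). The k-th one
-- counts the j < p with qj ≤ k and qj ≡ k mod p; there is at most one, as q is invertible mod p.
theorem truncSum_one_mem {p q μ l : ℕ} (hμ : μ < q) (hl : l < p)
    (h : μ * p + l * q = p * q + 1) (hpq : Nat.Coprime p q) (k : ℕ) :
    0 ≤ truncSum p q μ l k (fun _ => 1) ∧ truncSum p q μ l k (fun _ => 1) ≤ 1 := by
  rcases k with _ | k
  · simp [truncSum_zero]
  have hp0 : 0 < p := by omega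
  have hq0 : 0 < q := by omega
  have hB := sum_blockWeight_mul_pow hμ hl h (PowerSeries.X : ℤ⟦X⟧)
  set B := ∑ i ∈ Finset.range q, ∑ j ∈ Finset.range p,
    (blockWeight μ l i j : ℤ⟦X⟧) * (PowerSeries.X : ℤ⟦X⟧) ^ blockExp p q μ l i j with hBdef
  set O : ℤ⟦X⟧ := PowerSeries.mk fun _ => 1 with hO
  set D : ℤ⟦X⟧ := PowerSeries.mk fun n => if p ∣ n then 1 else 0 with hD
  have hO1 : O * (PowerSeries.X - 1) = -1 := by
    have := PowerSeries.mk_one_mul_one_sub_eq_one ℤ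
    change O * (1 - PowerSeries.X) = 1 at this
    linear_combination -this
  have hD1 : D * (PowerSeries.X ^ p - 1) = -1 := by
    ext n
    rw [mul_sub, mul_one, map_sub, PowerSeries.coeff_mul_X_pow', hD, PowerSeries.coeff_mk, map_neg, PowerSeries.coeff_one]
    by_cases hn : p ≤ n
    · rw [if_pos hn, PowerSeries.coeff_mk, if_neg (show n ≠ 0 by omega)]
      have : p ∣ n - p ↔ p ∣ n := Nat.dvd_sub_iff_left hn dvd_rfl
      simp [this]
    · rw [if_neg hn]
      by_cases h0 : n = 0
      · simp [h0]
      · rw [if_neg h0, PowerSeries.coeff_mk, if_neg fun hd => hn (Nat.le_of_dvd (by omega) hd)]; simp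
  have ne := @PowerSeries.X_pow_sub_one_ne_zero
  have hBO : B * O = (∑ j ∈ Finset.range p, (PowerSeries.X ^ q) ^ j) * D := by
    have ne1 : (PowerSeries.X : ℤ⟦X⟧) - 1 ≠ 0 := by simpa using ne one_pos
    refine mul_right_cancel₀ (mul_ne_zero (mul_ne_zero (ne hp0) (ne hq0)) ne1) ?_
    have hg := geom_sum_mul ((PowerSeries.X : ℤ⟦X⟧) ^ q) p
    rw [← pow_mul, mul_comm q p] at hg
    linear_combination O * (PowerSeries.X - 1) * hB + (PowerSeries.X ^ (p * q) - 1) * (PowerSeries.X - 1) * hO1 -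
      D * (PowerSeries.X ^ p - 1) * (PowerSeries.X - 1) * hg - (PowerSeries.X ^ (p * q) - 1) * (PowerSeries.X - 1) * hD1
  have hc := congrArg (PowerSeries.coeff k) hBO
  have h1 : PowerSeries.coeff k (B * O) = truncSum p q μ l (k + 1) (fun _ => 1) := by
    rw [hBdef, Finset.sum_mul, map_sum, truncSum]
    refine Finset.sum_congr rfl fun i _ => ?_
    rw [Finset.sum_mul, map_sum]
    refine Finset.sum_congr rfl fun j _ => ?_
    rw [mul_assoc, ← map_intCast (PowerSeries.C (R := ℤ)), PowerSeries.coeff_C_mul, PowerSeries.coeff_X_pow_mul', hO,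
      Int.cast_id]
    simp only [Nat.lt_succ_iff, PowerSeries.coeff_mk]
  rw [← h1, hc, Finset.sum_mul, map_sum]
  have h2 : ∀ j ∈ Finset.range p, PowerSeries.coeff k (((PowerSeries.X : ℤ⟦X⟧) ^ q) ^ j * D) =
      if q * j ≤ k ∧ p ∣ k - q * j then 1 else 0 := by
    intro j _
    rw [← pow_mul, PowerSeries.coeff_X_pow_mul', hD, PowerSeries.coeff_mk]
    split_ifs <;> simp_all
  rw [Finset.sum_congr rfl h2, Finset.sum_boole]
  refine ⟨Int.natCast_nonneg _, ?_⟩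
  norm_cast
  rw [Finset.card_le_one]
  intro a ha b hb
  simp only [Finset.mem_filter, Finset.mem_range] at ha hb
  obtain ⟨ha, ha1, ha2⟩ := ha
  obtain ⟨hb, hb1, hb2⟩ := hb
  have h3 : q * a ≡ q * b [MOD p] :=
    ((Nat.modEq_iff_dvd' ha1).2 ha2).trans ((Nat.modEq_iff_dvd' hb1).2 hb2).symm
  exact Nat.ModEq.eq_of_lt_of_lt (Nat.ModEq.cancel_left_of_coprime hpq h3) ha hb

/-! ### Window sums and their dependence on r modulo pq -/

/-- The parameters of the product expansion of
`(Y ^ (p * q) - 1) * (Y - 1) / ((Y ^ p - 1) * (Y ^ q - 1))`. -/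
structure IsBlockData (p q μ l : ℕ) : Prop where
  lt : p < q
  add_lt_mul : p + q < p * q
  coprime : Nat.Coprime p q
  left_lt : μ < q
  right_lt : l < p
  eq : μ * p + l * q = p * q + 1

theorem exists_isBlockData {p q : ℕ} (hp : 3 ≤ p) (hpq : p < q) (h : Nat.Coprime p q) :
    ∃ μ l, IsBlockData p q μ l := by
  obtain ⟨μ, l, hμ, hl, he⟩ := exists_mul_add_mul_eq (by omega) (by omega) h
  exact ⟨μ, l, hpq, by nlinarith, h, hμ, hl, he⟩

/-- The sums expressing the coefficients of ternary inclusion-exclusion polynomials. -/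
def windowSum (p q μ l : ℕ) (ρ : ℤ) (k : ℕ) (c : ℤ) : ℤ :=
  truncSum p q μ l k fun m => window p q (c - ρ * m)

theorem window_congr {p q : ℕ} {u v : ℤ} (h : u ≡ v [ZMOD ((p * q : ℕ) : ℤ)]) :
    window p q u = window p q v := by
  unfold window; rw [h]

theorem window_eq_one {p q : ℕ} {u : ℤ} (hpq : p < q) (h : u % (p * q : ℕ) < p) :
    window p q u = 1 := by
  unfold window
  rw [if_pos h, if_neg (by rintro ⟨h1, -⟩; exact absurd (h1.trans_lt h) (by omega))]
  rfl

theorem window_eq_neg_one {p q : ℕ} {u : ℤ} (hpq : p < q) (h : (q : ℤ) ≤ u % (p * q : ℕ))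
    (h' : u % (p * q : ℕ) < p + q) : window p q u = -1 := by
  unfold window
  rw [if_neg (fun h1 => absurd (h.trans_lt h1) (by omega)), if_pos ⟨h, h'⟩]
  rfl

theorem window_eq_zero_of_lt {p q : ℕ} {u : ℤ} (h : (p : ℤ) ≤ u % (p * q : ℕ))
    (h' : u % (p * q : ℕ) < q) : window p q u = 0 := by
  unfold window
  rw [if_neg (not_lt.2 h), if_neg (fun h1 => absurd h1.1 (not_le.2 h'))]
  rfl

theorem window_eq_zero_of_le {p q : ℕ} {u : ℤ} (h : (p + q : ℤ) ≤ u % (p * q : ℕ)) :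
    window p q u = 0 := by
  unfold window
  rw [if_neg (not_lt.2 (le_trans (by omega) h)), if_neg (fun h1 => absurd h1.2 (not_lt.2 h))]
  rfl

/-- The map u ↦ p+q-1-u interchanges [0,p) and [q,p+q), where the window is 1 and -1. -/
theorem window_reflect {p q : ℕ} (hN : p + q < p * q) (hpq : p < q) (u : ℤ) :
    window p q (p + q - 1 - u) = - window p q u := by
  unfold window
  have hN0 : (0 : ℤ) < (p * q : ℕ) := by omega
  have h1 : (p + q - 1 - u) % (p * q : ℕ) = (p + q - 1 - u % (p * q : ℕ)) % (p * q : ℕ) := by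
    rw [Int.sub_emod_emod]
  have h2 := Int.emod_nonneg u hN0.ne'
  have h3 := Int.emod_lt_of_pos u hN0
  rw [h1]
  generalize u % (p * q : ℕ) = v at *
  by_cases h : v < p + q
  · rw [Int.emod_eq_of_lt (by omega) (by omega)]
    split_ifs <;> omega
  · rw [← Int.add_emod_right, Int.emod_eq_of_lt (by omega) (by omega)]
    split_ifs <;> omega

theorem windowSum_zero (p q μ l : ℕ) (ρ c : ℤ) : windowSum p q μ l ρ 0 c = 0 :=
  truncSum_zero _ _ _ _ _

theorem windowSum_succ (p q μ l : ℕ) (ρ : ℤ) (k : ℕ) (c : ℤ) :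
    windowSum p q μ l ρ (k + 1) c = windowSum p q μ l ρ k c +
      (truncSum p q μ l (k + 1) (fun _ => 1) - truncSum p q μ l k (fun _ => 1)) *
        window p q (c - ρ * k) :=
  truncSum_succ _ _ _ _ _ _

theorem windowSum_congr {p q : ℕ} (μ l : ℕ) {ρ ρ' : ℤ} (h : ρ ≡ ρ' [ZMOD ((p * q : ℕ) : ℤ)])
    (k : ℕ) (c : ℤ) : windowSum p q μ l ρ k c = windowSum p q μ l ρ' k c := by
  unfold windowSum
  congr 1
  funext m
  exact window_congr (Int.ModEq.rfl.sub (h.mul_right _))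

theorem windowSum_neg {p q : ℕ} (μ l : ℕ) (hN : p + q < p * q) (hpq : p < q) (ρ : ℤ) (k : ℕ)
    (c : ℤ) : windowSum p q μ l (-ρ) k c = - windowSum p q μ l ρ k (p + q - 1 - c) := by
  simp only [windowSum, truncSum, ← Finset.sum_neg_distrib]
  refine Finset.sum_congr rfl fun i _ => Finset.sum_congr rfl fun j _ => ?_
  generalize blockExp p q μ l i j = e
  have h := window_reflect hN hpq (c - -ρ * e)
  rw [show (p + q - 1 - (c - -ρ * e) : ℤ) = p + q - 1 - c - ρ * e by ring] at h
  rw [h]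
  split_ifs <;> simp

theorem sub_emod_of_le {x r N : ℤ} (hr : 0 ≤ r) (hN : 0 < N) (h : r ≤ x % N) :
    (x - r) % N = x % N - r := by
  rw [← Int.emod_sub_emod, Int.emod_eq_of_lt (by omega)]
  have := Int.emod_lt_of_pos x hN
  omega

theorem add_emod_of_lt {x r N : ℤ} (hr : 0 ≤ r) (hN : 0 < N) (h : x % N + r < N) :
    (x + r) % N = x % N + r := by
  rw [← Int.emod_add_emod, Int.emod_eq_of_lt _ h]
  have := Int.emod_nonneg x hN.ne'
  omega

theorem add_emod_of_le {x r N : ℤ} (hr : r ≤ N) (hN : 0 < N) (h : N ≤ x % N + r) :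
    (x + r) % N = x % N + r - N := by
  rw [← Int.emod_add_emod, ← Int.sub_emod_right, Int.emod_eq_of_lt (by omega)]
  have := Int.emod_lt_of_pos x hN
  omega

/-! ### Window sums compared with true coefficients -/

theorem exists_coeff_eq_windowSum {p q μ l r : ℕ} (hN : 0 < p * q) {f : ℕ → ℤ}
    (hf : ∀ n, f n = windowSum p q μ l r (n / r + 1) n) {k : ℕ} {c : ℤ}
    (h : (c - r * k) % (p * q : ℕ) < r) : ∃ n, f n = windowSum p q μ l r (k + 1) c := by
  have h0 := Int.emod_nonneg (c - r * k) (b := (p * q : ℕ)) (by exact_mod_cast hN.ne')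
  have h1 := Int.emod_add_mul_ediv (c - r * k) (p * q : ℕ)
  generalize (c - r * k) / (p * q : ℕ) = d at h1
  generalize (c - r * k) % (p * q : ℕ) = u at h h0 h1
  lift u to ℕ using h0
  have hr : u < r := by exact_mod_cast h
  -- This index is congruent to c mod pq, and u < r makes its quotient by r equal to k.
  refine ⟨r * k + u, ?_⟩
  rw [hf, Nat.mul_add_div (by omega), Nat.div_eq_of_lt hr, add_zero]
  unfold windowSum
  congr 1
  funext m
  apply window_congr
  rw [Int.modEq_iff_dvd]
  exact ⟨d, by push_cast; push_cast at h1; linear_combination -h1⟩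

/-- Let u be the residue of c - rk. If u ≥ p+q, the last term vanishes. If r ≤ u < p+q, the window
is -1 at u and 1 at u - r < p, so S(k+1) = S(k) - b_k and S(k+2) = S(k+1) + b_{k+1}. By σ ∈ {0,1},
b_k and b_{k+1} cannot be nonzero of the same sign, so S(k+1) cannot leave an interval containing
S(k) and S(k+2). -/
theorem windowSum_mem_Icc {p q μ l r : ℕ} (hb : IsBlockData p q μ l) (hr : q ≤ r) {a b : ℤ}
    (ha : a ≤ 0) (hb0 : 0 ≤ b)
    (h : ∀ (k : ℕ) (c : ℤ), (c - r * k) % (p * q : ℕ) < r → windowSum p q μ l r (k + 1) c ∈ Set.Icc a b)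
    (k : ℕ) (c : ℤ) : windowSum p q μ l r k c ∈ Set.Icc a b := by
  have hpq := hb.lt
  have hN := hb.add_lt_mul
  have hN0 : (0 : ℤ) < (p * q : ℕ) := by omega
  induction k with
  | zero => rw [windowSum_zero]; exact ⟨ha, hb0⟩
  | succ k ih =>
    by_cases h1 : (c - r * k) % (p * q : ℕ) < r
    · exact h k c h1
    rw [not_lt] at h1
    have e1 := windowSum_succ p q μ l r k c
    by_cases h2 : (p + q : ℤ) ≤ (c - r * k) % (p * q : ℕ)
    · rw [window_eq_zero_of_le h2, mul_zero, add_zero] at e1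
      rwa [e1]
    rw [not_le] at h2
    rw [window_eq_neg_one hpq (le_trans (by omega) h1) h2] at e1
    have e3 : (c - r * (k + 1 : ℕ)) % (p * q : ℕ) = (c - r * k) % (p * q : ℕ) - r := by
      rw [← sub_emod_of_le (by omega) hN0 h1]
      congr 1
      push_cast
      ring
    have e2 := windowSum_succ p q μ l r (k + 1) c
    rw [window_eq_one hpq (by rw [e3]; omega)] at e2
    have h3 := h (k + 1) c (by rw [e3]; omega)
    have s0 := truncSum_one_mem hb.left_lt hb.right_lt hb.eq hb.coprime k
    have s1 := truncSum_one_mem hb.left_lt hb.right_lt hb.eq hb.coprime (k + 1)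
    have s2 := truncSum_one_mem hb.left_lt hb.right_lt hb.eq hb.coprime (k + 1 + 1)
    rw [Set.mem_Icc] at *
    omega

/-- Lowering k raises the residue of c - sk by s. Above p+q the window is 0 and S is constant; on
[q,p+q) it is -1 and S + σ is constant. The walk ends at the empty sum 0, or wraps past pq to a
residue below s, a true coefficient. The number ε is the value of σ on entering [q,p+q). -/
theorem exists_windowSum_eq_of_le {p q μ l s : ℕ} (hb : IsBlockData p q μ l) (hs : s < q)
    {R : ℤ → Prop} (h0 : R 0)
    (h : ∀ (k : ℕ) (c : ℤ), (c - s * k) % (p * q : ℕ) < s → R (windowSum p q μ l s (k + 1) c))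
    (c : ℤ) (k : ℕ) (hu : (q : ℤ) ≤ (c - s * k) % (p * q : ℕ)) :
    ∃ V, R V ∧ ((p + q : ℤ) ≤ (c - s * k) % (p * q : ℕ) → windowSum p q μ l s (k + 1) c = V) ∧
      ((c - s * k) % (p * q : ℕ) < p + q → ∃ ε, 0 ≤ ε ∧ ε ≤ 1 ∧
        windowSum p q μ l s (k + 1) c = V - truncSum p q μ l (k + 1) (fun _ => 1) + ε) := by
  have hpq := hb.lt
  have hN := hb.add_lt_mul
  have hN0 : (0 : ℤ) < (p * q : ℕ) := by omega
  have hσ := truncSum_one_mem hb.left_lt hb.right_lt hb.eq hb.coprime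
  induction k with
  | zero =>
    have e1 := windowSum_succ p q μ l s 0 c
    rw [windowSum_zero] at e1
    refine ⟨0, h0, fun h1 => ?_, fun h1 => ⟨_, (hσ 0).1, (hσ 0).2, ?_⟩⟩
    · rw [e1, window_eq_zero_of_le h1]; ring
    · rw [e1, window_eq_neg_one hpq hu h1]; ring
  | succ k ih =>
    have e1 := windowSum_succ p q μ l s (k + 1) c
    have e3 : (c - s * k) = c - s * (k + 1 : ℕ) + s := by push_cast; ring
    by_cases h2 : (c - s * (k + 1 : ℕ)) % (p * q : ℕ) + s < (p * q : ℕ)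
    · have e4 := add_emod_of_lt (by omega) hN0 h2
      rw [← e3] at e4
      obtain ⟨V, hV, hV1, hV2⟩ := ih (by omega)
      refine ⟨V, hV, fun h1 => ?_, fun h1 => ?_⟩
      · rw [e1, window_eq_zero_of_le h1, mul_zero, add_zero]
        exact hV1 (by omega)
      · rw [window_eq_neg_one hpq hu h1] at e1
        by_cases h3 : (p + q : ℤ) ≤ (c - s * k) % (p * q : ℕ)
        · refine ⟨_, (hσ (k + 1)).1, (hσ (k + 1)).2, ?_⟩
          rw [e1, hV1 h3]; ring
        · obtain ⟨ε, hε, hε', h4⟩ := hV2 (by omega)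
          refine ⟨ε, hε, hε', ?_⟩
          rw [e1, h4]; ring
    · have e4 := add_emod_of_le (x := c - s * (k + 1 : ℕ)) (r := s) (by omega) hN0 (by omega)
      rw [← e3] at e4
      have h5 := Int.emod_lt_of_pos (c - s * (k + 1 : ℕ)) hN0
      refine ⟨_, h k c (by omega), fun h1 => ?_, fun h1 => ⟨_, (hσ (k + 1)).1, (hσ (k + 1)).2, ?_⟩⟩
      · rw [e1, window_eq_zero_of_le h1]; ring
      · rw [e1, window_eq_neg_one hpq hu h1]; ring

/-- Raising k lowers the residue by s until it is below s, where S is a true coefficient V. A step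
landing in [p,q) leaves S unchanged; a step landing in [0,p) preserves S - σ. Thus the total error
is a difference of two values of σ. The bound t on the residue carries the induction. -/
theorem exists_abs_windowSum_sub_le_of_lt {p q μ l s : ℕ} (hb : IsBlockData p q μ l) (hs0 : 0 < s)
    {R : ℤ → Prop}
    (h : ∀ (k : ℕ) (c : ℤ), (c - s * k) % (p * q : ℕ) < s → R (windowSum p q μ l s (k + 1) c))
    (c : ℤ) (t : ℕ) : ∀ k : ℕ, (c - s * k) % (p * q : ℕ) < q → (c - s * k) % (p * q : ℕ) ≤ t →
    ∃ V, R V ∧ |windowSum p q μ l s (k + 1) c - V| ≤ 1 ∧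
      ((c - s * k) % (p * q : ℕ) < p + s → ∃ ε, 0 ≤ ε ∧ ε ≤ 1 ∧
        windowSum p q μ l s (k + 1) c = V + truncSum p q μ l (k + 1) (fun _ => 1) - ε) := by
  have hpq := hb.lt
  have hN := hb.add_lt_mul
  have hN0 : (0 : ℤ) < (p * q : ℕ) := by omega
  have hσ := truncSum_one_mem hb.left_lt hb.right_lt hb.eq hb.coprime
  have base : ∀ k : ℕ, (c - s * k) % (p * q : ℕ) < s →
      ∃ V, R V ∧ |windowSum p q μ l s (k + 1) c - V| ≤ 1 ∧
      ((c - s * k) % (p * q : ℕ) < p + s → ∃ ε, 0 ≤ ε ∧ ε ≤ 1 ∧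
        windowSum p q μ l s (k + 1) c = V + truncSum p q μ l (k + 1) (fun _ => 1) - ε) :=
    fun k hk => ⟨_, h k c hk, by simp, fun _ => ⟨_, (hσ (k + 1)).1, (hσ (k + 1)).2, by ring⟩⟩
  induction t with
  | zero => exact fun k _ hk => base k (by omega)
  | succ t ih =>
    intro k hq ht
    by_cases hk : (c - s * k) % (p * q : ℕ) < s
    · exact base k hk
    rw [not_lt] at hk
    have e3 : (c - s * (k + 1 : ℕ)) % (p * q : ℕ) = (c - s * k) % (p * q : ℕ) - s := by
      rw [← sub_emod_of_le (by omega) hN0 hk]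
      congr 1
      push_cast
      ring
    obtain ⟨V, hV, hV1, hV2⟩ := ih (k + 1) (by omega) (by omega)
    have e1 := windowSum_succ p q μ l s (k + 1) c
    by_cases h1 : (c - s * k) % (p * q : ℕ) < p + s
    · rw [window_eq_one hpq (by omega)] at e1
      obtain ⟨ε, hε, hε', h4⟩ := hV2 (by omega)
      have h5 := hσ (k + 1)
      refine ⟨V, hV, ?_, fun _ => ⟨ε, hε, hε', ?_⟩⟩
      · rw [abs_le]; omega
      · omega
    · rw [window_eq_zero_of_lt (by omega) (by omega), mul_zero, add_zero] at e1
      rw [e1] at hV1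
      exact ⟨V, hV, hV1, fun h2 => absurd h2 h1⟩

theorem exists_abs_windowSum_sub_le {p q μ l s : ℕ} (hb : IsBlockData p q μ l) (hs0 : 0 < s)
    (hs : s < q) {R : ℤ → Prop} (h0 : R 0)
    (h : ∀ (k : ℕ) (c : ℤ), (c - s * k) % (p * q : ℕ) < s → R (windowSum p q μ l s (k + 1) c))
    (k : ℕ) (c : ℤ) : ∃ V, R V ∧ |windowSum p q μ l s k c - V| ≤ 1 := by
  rcases k with _ | k
  · exact ⟨0, h0, by simp [windowSum_zero]⟩
  by_cases hq : (c - s * k) % (p * q : ℕ) < q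
  · obtain ⟨V, hV, hV1, -⟩ := exists_abs_windowSum_sub_le_of_lt hb hs0 h c
      ((c - s * k) % (p * q : ℕ)).toNat k hq (Int.self_le_toNat _)
    exact ⟨V, hV, hV1⟩
  · obtain ⟨V, hV, hV1, hV2⟩ := exists_windowSum_eq_of_le hb hs h0 h c k (not_lt.1 hq)
    refine ⟨V, hV, ?_⟩
    rw [abs_le]
    have h5 := truncSum_one_mem hb.left_lt hb.right_lt hb.eq hb.coprime (k + 1)
    by_cases h1 : (c - s * k) % (p * q : ℕ) < p + q
    · obtain ⟨ε, hε, hε', h4⟩ := hV2 h1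
      omega
    · have := hV1 (not_lt.1 h1)
      omega

/-! ### Adjacent coefficients differ by at most one -/

/-- The window jumps by +1, -1, -1, +1 at the residues 0, p, q, p+q; by the Chinese remainder
theorem each jump is a condition mod q and one mod p. -/
theorem window_sub_window {p q : ℕ} (hN : p + q < p * q) (hpq : p < q) (hc : Nat.Coprime p q)
    (u : ℤ) : window p q u - window p q (u - 1) =
      ((if (q : ℤ) ∣ u then 1 else 0) - (if (q : ℤ) ∣ u - p then 1 else 0)) *
        ((if (p : ℤ) ∣ u then 1 else 0) - (if (p : ℤ) ∣ u - q then 1 else 0)) := by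
  have hN0 : (0 : ℤ) < (p * q : ℕ) := by omega
  have hd : ∀ x y z : ℤ, (q : ℤ) ∣ x - y → (p : ℤ) ∣ x - z →
      (((p * q : ℕ) : ℤ) ∣ x ↔ (q : ℤ) ∣ y ∧ (p : ℤ) ∣ z) := by
    intro x y z h1 h2
    rw [← dvd_iff_dvd_of_dvd_sub h1, ← dvd_iff_dvd_of_dvd_sub h2, Nat.cast_mul]
    exact ⟨fun h => ⟨dvd_of_mul_left_dvd h, dvd_of_mul_right_dvd h⟩,
      fun h => (Nat.isCoprime_iff_coprime.2 hc).mul_dvd h.2 h.1⟩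
  have hm : ∀ a : ℤ, 0 ≤ a → a < (p * q : ℕ) →
      (((p * q : ℕ) : ℤ) ∣ u - a ↔ u % (p * q : ℕ) = a) := by
    intro a h1 h2
    rw [← Int.modEq_iff_dvd, Int.ModEq, Int.emod_eq_of_lt h1 h2, eq_comm]
  have c1 := hd (u - 0) u u (by simp) (by simp)
  have c2 := hd (u - p) (u - p) u (by simp) (by simp)
  have c3 := hd (u - q) u (u - q) (by simp) (by simp)
  have c4 := hd (u - (p + q)) (u - p) (u - q) (by ring_nf; simp) (by ring_nf; simp)
  rw [hm _ (by omega) (by omega)] at c1 c2 c3 c4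
  have key : window p q u - window p q (u - 1) =
      (if u % (p * q : ℕ) = 0 then 1 else 0) - (if u % (p * q : ℕ) = p then 1 else 0)
        - (if u % (p * q : ℕ) = q then 1 else 0)
        + (if u % (p * q : ℕ) = p + q then 1 else 0) := by
    have h2 := Int.emod_nonneg u hN0.ne'
    have h3 := Int.emod_lt_of_pos u hN0
    unfold window
    rcases h2.eq_or_lt with h0 | h0
    · have h4 : (u - 1) % (p * q : ℕ) = (p * q : ℕ) - 1 := by
        rw [← Int.emod_sub_emod, ← h0, ← Int.add_emod_right, Int.emod_eq_of_lt] <;> omega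
      rw [h4, ← h0]
      split_ifs <;> omega
    · rw [sub_emod_of_le zero_le_one hN0 h0]
      generalize u % (p * q : ℕ) = v at *
      split_ifs <;> omega
  rw [key]
  simp only [c1, c2, c3, c4, ite_and]
  split_ifs <;> rfl

/-- As m is invertible mod q, the congruence mj ≡ x has one solution; it singles out a row or a
column of the grid. -/
theorem exists_lt_forall_dvd_iff {q m : ℕ} (hq : 0 < q) (h : Nat.Coprime q m) (x : ℤ) :
    ∃ i < q, ∀ j < q, (q : ℤ) ∣ x - m * j ↔ j = i := by
  obtain ⟨a, b, hab⟩ := Nat.isCoprime_iff_coprime.2 h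
  have hq0 : (0 : ℤ) < q := by exact_mod_cast hq
  have h0 := Int.emod_nonneg (x * b) hq0.ne'
  have h1 := Int.emod_lt_of_pos (x * b) hq0
  have h2 := Int.emod_add_mul_ediv (x * b) q
  generalize x * b / q = d at h2
  generalize x * b % q = i at h0 h1 h2
  lift i to ℕ using h0
  have h3 : (q : ℤ) ∣ x - m * i := ⟨x * a + m * d, by linear_combination -x * hab - m * h2⟩
  refine ⟨i, by exact_mod_cast h1, fun j hj => ⟨fun h4 => ?_, fun h4 => h4 ▸ h3⟩⟩
  have h5 : (q : ℤ) ∣ m * ((i : ℤ) - j) := by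
    have := dvd_sub h4 h3
    rwa [show x - m * j - (x - m * i) = m * ((i : ℤ) - j) by ring] at this
  have h6 := (Nat.isCoprime_iff_coprime.2 h).dvd_of_dvd_mul_left h5
  rw [← Int.modEq_iff_dvd, Int.natCast_modEq_iff] at h6
  exact h6.eq_of_lt_of_lt hj (by exact_mod_cast h1)

theorem sum_corner {m n i₀ i₁ j₀ j₁ : ℕ} (hi₀ : i₀ < m) (hi₁ : i₁ < m) (hj₀ : j₀ < n) (hj₁ : j₁ < n)
    (g : ℕ → ℕ → ℤ) :
    ∑ i ∈ Finset.range m, ∑ j ∈ Finset.range n, g i j *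
      (((if i = i₀ then 1 else 0) - (if i = i₁ then 1 else 0)) *
        ((if j = j₀ then 1 else 0) - (if j = j₁ then 1 else 0))) =
      g i₀ j₀ - g i₀ j₁ - g i₁ j₀ + g i₁ j₁ := by
  have h1 : ∀ i, ∑ j ∈ Finset.range n, g i j *
      (((if i = i₀ then 1 else 0) - (if i = i₁ then 1 else 0)) *
        ((if j = j₀ then 1 else 0) - (if j = j₁ then 1 else 0))) =
      ((if i = i₀ then 1 else 0) - (if i = i₁ then 1 else 0)) * (g i j₀ - g i j₁) := by
    intro i
    simp only [mul_left_comm (g i _), ← Finset.mul_sum]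
    simp [mul_sub, Finset.sum_sub_distrib, hj₀, hj₁]
  rw [Finset.sum_congr rfl fun i _ => h1 i]
  simp [sub_mul, Finset.sum_sub_distrib, hi₀, hi₁]
  ring

/-- Diagonally opposite corners in different blocks have values of opposite sign or 0. Within one
block both diagonals have the same total of a + b, so a threshold on a + b cannot hold on one whole
diagonal and fail on the whole other one. -/
theorem abs_corner_sum_le_one {a₀ a₁ b₀ b₁ M L k N : ℕ} {g : ℕ → ℕ → ℤ}
    (hg : ∀ a b, g a b = if a < M ∧ b < L then if a + b < k then 1 else 0 else
      if M ≤ a ∧ L ≤ b then if a + b < k + N then -1 else 0 else 0) :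
    |g a₀ b₀ - g a₀ b₁ - g a₁ b₀ + g a₁ b₁| ≤ 1 := by
  rw [abs_le, hg, hg, hg, hg]
  rcases lt_or_ge a₀ M with h1 | h1 <;> rcases lt_or_ge a₁ M with h2 | h2 <;>
  rcases lt_or_ge b₀ L with h3 | h3 <;> rcases lt_or_ge b₁ L with h4 | h4 <;>
  simp only [h1, h2, h3, h4, not_lt.2, not_le.2, and_true, and_false, if_true, if_false,
    and_self] <;>
  (try split_ifs) <;> omega

theorem mul_lt_of_block {p q μ l i j : ℕ} (hb : IsBlockData p q μ l) (hi : μ ≤ i) (hj : l ≤ j) :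
    p * q < i * p + j * q := by
  have := Nat.mul_le_mul_right p hi
  have := Nat.mul_le_mul_right q hj
  have := hb.eq
  omega

theorem exists_blockExp_eq {p q μ l : ℕ} (hb : IsBlockData p q μ l) (i j : ℕ) :
    ∃ t : ℤ, (blockExp p q μ l i j : ℤ) = i * p + j * q + t * (p * q) := by
  unfold blockExp
  split_ifs with h
  · refine ⟨-1, ?_⟩
    rw [Nat.cast_sub (mul_lt_of_block hb h.1 h.2).le]
    push_cast
    ring
  · exact ⟨0, by push_cast; ring⟩

/-- Both neighbouring coefficients can use the same truncation: an additional term would carry the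
window at -1 ≡ pq - 1, which is 0 since pq - 1 ≥ p + q. -/
theorem windowSum_succ_div {p q μ l r : ℕ} (hN : p + q < p * q) (n : ℕ) :
    windowSum p q μ l r ((n + 1) / r + 1) n = windowSum p q μ l r (n / r + 1) n := by
  by_cases hd : r ∣ n + 1
  · have h1 : (n + 1) / r = n / r + 1 := by rw [Nat.succ_div, if_pos hd]
    rw [h1, windowSum_succ _ _ _ _ _ (n / r + 1), window_eq_zero_of_le, mul_zero, add_zero]
    have h2 : (n : ℤ) - r * (n / r + 1 : ℕ) = -1 := by
      have h3 : r * (n / r + 1) = n + 1 := by rw [← h1, Nat.mul_div_cancel' hd]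
      have h4 : (r : ℤ) * (n / r + 1 : ℕ) = n + 1 := by exact_mod_cast h3
      rw [h4]
      ring
    rw [h2, ← Int.add_emod_right, Int.emod_eq_of_lt] <;> omega
  · rw [Nat.succ_div, if_neg hd, add_zero]

/-- With a = ip and b = jq, the truncation becomes a threshold on a + b, shifted by pq in the
negative block, as `abs_corner_sum_le_one` requires. -/
theorem truncated_blockWeight_eq {p q μ l : ℕ} (hb : IsBlockData p q μ l) (K i j : ℕ) :
    (blockWeight μ l i j * if blockExp p q μ l i j < K then 1 else 0) =
      if i * p < μ * p ∧ j * q < l * q then if i * p + j * q < K then 1 else 0 else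
      if μ * p ≤ i * p ∧ l * q ≤ j * q then if i * p + j * q < K + p * q then -1 else 0 else 0 := by
  have hp0 : 0 < p := by have := hb.right_lt; omega
  have hq0 : 0 < q := hp0.trans hb.lt
  have e1 : i * p < μ * p ↔ i < μ := Nat.mul_lt_mul_right hp0
  have e2 : j * q < l * q ↔ j < l := Nat.mul_lt_mul_right hq0
  have e3 : μ * p ≤ i * p ↔ ¬ i < μ := by rw [← e1, not_lt]
  have e4 : l * q ≤ j * q ↔ ¬ j < l := by rw [← e2, not_lt]
  have e5 : μ ≤ i ↔ ¬ i < μ := not_lt.symm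
  have e6 : l ≤ j ↔ ¬ j < l := not_lt.symm
  have hlt : ¬ i < μ → ¬ j < l → p * q < i * p + j * q :=
    fun hi hj => mul_lt_of_block hb (not_lt.1 hi) (not_lt.1 hj)
  simp only [blockWeight, blockExp, e1, e2, e3, e4, e5, e6]
  by_cases hi : i < μ <;> by_cases hj : j < l <;> simp only [hi, hj]
  · simp
  · simp
  · simp
  · have := hlt hi hj
    simp only [not_false_eq_true, and_self, if_true, if_false]
    split_ifs <;> omega

theorem abs_sub_le_one_of_eq_windowSum {p q μ l r : ℕ} (hb : IsBlockData p q μ l)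
    (hpr : Nat.Coprime p r) (hqr : Nat.Coprime q r) {f : ℕ → ℤ}
    (hf : ∀ n, f n = windowSum p q μ l r (n / r + 1) n) (n : ℕ) : |f (n + 1) - f n| ≤ 1 := by
  have hpq := hb.lt
  have hN := hb.add_lt_mul
  have hp0 : 0 < p := by have := hb.right_lt; omega
  have h1 : f n = windowSum p q μ l r ((n + 1) / r + 1) n := by rw [hf, windowSum_succ_div hN]
  have h2 := hf (n + 1)
  generalize (n + 1) / r + 1 = K at h1 h2
  obtain ⟨i₀, hi₀, hi₀'⟩ := exists_lt_forall_dvd_iff (m := r * p) (hp0.trans hpq)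
    (hqr.mul_right hb.coprime.symm) (n + 1)
  obtain ⟨i₁, hi₁, hi₁'⟩ := exists_lt_forall_dvd_iff (m := r * p) (hp0.trans hpq)
    (hqr.mul_right hb.coprime.symm) (n + 1 - p)
  obtain ⟨j₀, hj₀, hj₀'⟩ := exists_lt_forall_dvd_iff (m := r * q) hp0
    (hpr.mul_right hb.coprime) (n + 1)
  obtain ⟨j₁, hj₁, hj₁'⟩ := exists_lt_forall_dvd_iff (m := r * q) hp0
    (hpr.mul_right hb.coprime) (n + 1 - q)
  have h3 : f (n + 1) - f n = ∑ i ∈ Finset.range q, ∑ j ∈ Finset.range p,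
      (blockWeight μ l i j * if blockExp p q μ l i j < K then 1 else 0) *
      (((if i = i₀ then 1 else 0) - (if i = i₁ then 1 else 0)) *
        ((if j = j₀ then 1 else 0) - (if j = j₁ then 1 else 0))) := by
    rw [h1, h2, windowSum, windowSum, truncSum, truncSum, ← Finset.sum_sub_distrib]
    refine Finset.sum_congr rfl fun i hi => ?_
    rw [← Finset.sum_sub_distrib]
    refine Finset.sum_congr rfl fun j hj => ?_
    rw [Finset.mem_range] at hi hj
    obtain ⟨t, ht⟩ := exists_blockExp_eq hb i j
    generalize blockExp p q μ l i j = e at ht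
    have hw := window_sub_window hN hpq hb.coprime (n + 1 - r * e)
    -- Since e ≡ ip mod q and e ≡ jq mod p, the conditions mod q see only i and those mod p only j.
    have a1 : (q : ℤ) ∣ n + 1 - r * e ↔ i = i₀ := by
      rw [← hi₀' i hi]
      exact dvd_iff_dvd_of_dvd_sub ⟨-(r * (j + t * p)), by rw [ht]; push_cast; ring⟩
    have a2 : (q : ℤ) ∣ n + 1 - r * e - p ↔ i = i₁ := by
      rw [← hi₁' i hi]
      exact dvd_iff_dvd_of_dvd_sub ⟨-(r * (j + t * p)), by rw [ht]; push_cast; ring⟩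
    have a3 : (p : ℤ) ∣ n + 1 - r * e ↔ j = j₀ := by
      rw [← hj₀' j hj]
      exact dvd_iff_dvd_of_dvd_sub ⟨-(r * (i + t * q)), by rw [ht]; push_cast; ring⟩
    have a4 : (p : ℤ) ∣ n + 1 - r * e - q ↔ j = j₁ := by
      rw [← hj₁' j hj]
      exact dvd_iff_dvd_of_dvd_sub ⟨-(r * (i + t * q)), by rw [ht]; push_cast; ring⟩
    simp only [a1, a2, a3, a4] at hw
    rw [← hw, show (n + 1 - r * e - 1 : ℤ) = n - r * e by ring]
    by_cases he : e < K
    · simp only [if_pos he]; push_cast; ring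
    · simp only [if_neg he]; ring
  rw [h3, sum_corner hi₀ hi₁ hj₀ hj₁]
  simp only [truncated_blockWeight_eq hb]
  exact abs_corner_sum_le_one (g := fun a b => if a < μ * p ∧ b < l * q then
    if a + b < K then 1 else 0 else if μ * p ≤ a ∧ l * q ≤ b then
    if a + b < K + p * q then -1 else 0 else 0) fun _ _ => rfl

/-! ### Coefficient sets, heights and the theorem -/

theorem coeffSet_eq_range {f : ℤ[X]} (h : (0 : ℤ) ∈ coeffSet f) :
    coeffSet f = Set.range f.coeff := by
  ext c
  constructor
  · rintro ⟨j, -, rfl⟩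
    exact ⟨j, rfl⟩
  · rintro ⟨j, rfl⟩
    by_cases hj : j ≤ f.natDegree
    · exact ⟨j, hj, rfl⟩
    · rwa [coeff_eq_zero_of_natDegree_lt (not_le.1 hj)]

/-- Below r the coefficients are a nonzero constant times the window: 0 at p, nonzero at q > p, so
index p does not exceed the degree. -/
theorem zero_mem_coeffSet {p q μ l r : ℕ} (hb : IsBlockData p q μ l) (hqr : q < r) {f : ℤ[X]}
    (hf : ∀ n, f.coeff n = windowSum p q μ l r (n / r + 1) n)
    (h0 : f.coeff 0 ≠ 0) : (0 : ℤ) ∈ coeffSet f := by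
  have hpq := hb.lt
  have hN := hb.add_lt_mul
  have key : ∀ n < r, f.coeff n = truncSum p q μ l 1 (fun _ => 1) * window p q n := by
    intro n hn
    rw [hf, Nat.div_eq_of_lt hn, windowSum_succ, windowSum_zero, truncSum_zero]
    simp
  rw [key 0 (by omega)] at h0
  have hp := key p (hpq.trans hqr)
  rw [window_eq_zero_of_lt, mul_zero] at hp
  · have hq := key q hqr
    rw [window_eq_neg_one hpq] at hq
    · refine ⟨p, hpq.le.trans (le_natDegree_of_ne_zero ?_), hp⟩
      rw [hq]; simpa using left_ne_zero_of_mul h0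
    · rw [Int.emod_eq_of_lt] <;> omega
    · have := hb.right_lt
      rw [Int.emod_eq_of_lt] <;> omega
  · rw [Int.emod_eq_of_lt] <;> omega
  · rw [Int.emod_eq_of_lt] <;> omega

theorem coeff_unitaryCyclotomic_eq {p q r μ l : ℕ} (hb : IsBlockData p q μ l)
    (hp : IsPrimePow p) (hq : IsPrimePow q) (hr : IsPrimePow r)
    (hpr : Nat.Coprime p r) (hqr : Nat.Coprime q r) (n : ℕ) :
    (unitaryCyclotomic (p * q * r)).coeff n = windowSum p q μ l r (n / r + 1) n :=
  coeff_eq_truncSum hb.left_lt hb.right_lt hb.eq hb.lt hb.add_lt_mul hr.pos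
    (unitaryCyclotomic_mul_mul hp hq hr hb.coprime hpr hqr) n

theorem coeff_zero_unitaryCyclotomic_ne_zero {p q r : ℕ}
    (hp : IsPrimePow p) (hq : IsPrimePow q) (hr : IsPrimePow r)
    (hpq : Nat.Coprime p q) (hpr : Nat.Coprime p r) (hqr : Nat.Coprime q r) :
    (unitaryCyclotomic (p * q * r)).coeff 0 ≠ 0 := by
  intro h
  have h1 := congrArg (eval 0) (unitaryCyclotomic_mul_mul hp hq hr hpq hpr hqr)
  rw [eval_mul, ← coeff_zero_eq_eval_zero, h, zero_mul] at h1
  simp [hp.ne_zero, hq.ne_zero, hr.ne_zero] at h1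

/-- The coefficients fill an interval containing 0, so the bounds of `windowSum_mem_Icc` become
membership. The right side depends on r only through its residue mod pq. -/
theorem coeffSet_unitaryCyclotomic_eq {p q r μ l : ℕ} (hb : IsBlockData p q μ l)
    (hp : IsPrimePow p) (hq : IsPrimePow q) (hr : IsPrimePow r)
    (hpr : Nat.Coprime p r) (hqr : Nat.Coprime q r) (hlt : q < r) :
    coeffSet (unitaryCyclotomic (p * q * r)) =
      {v | ∃ k c, windowSum p q μ l r k c = v} := by
  have hf := coeff_unitaryCyclotomic_eq hb hp hq hr hpr hqr
  have h0 := zero_mem_coeffSet hb hlt hf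
    (coeff_zero_unitaryCyclotomic_ne_zero hp hq hr hb.coprime hpr hqr)
  obtain ⟨a, b, hab, hI⟩ := isConsecutiveString_coeffSet
    (abs_sub_le_one_of_eq_windowSum hb hpr hqr hf)
  refine Set.Subset.antisymm ?_ ?_
  · rintro _ ⟨j, -, rfl⟩
    exact ⟨_, _, (hf j).symm⟩
  · rintro _ ⟨k, c, rfl⟩
    have h1 := hI ▸ h0
    rw [hI]
    refine windowSum_mem_Icc hb hlt.le h1.1 h1.2 (fun k c hk => ?_) k c
    obtain ⟨n, hn⟩ := exists_coeff_eq_windowSum (Nat.mul_pos hp.pos hq.pos) hf hk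
    rw [← hn, ← hI, coeffSet_eq_range h0]
    exact ⟨n, rfl⟩

theorem natAbs_windowSum_eq_of_modEq {p q μ l : ℕ} (hb : IsBlockData p q μ l) {ρ ρ' : ℤ}
    (h : ρ ≡ ρ' [ZMOD ((p * q : ℕ) : ℤ)] ∨ ρ ≡ -ρ' [ZMOD ((p * q : ℕ) : ℤ)]) (k : ℕ) (c : ℤ) :
    ∃ c', (windowSum p q μ l ρ k c).natAbs = (windowSum p q μ l ρ' k c').natAbs := by
  rcases h with h | h
  · exact ⟨c, by rw [windowSum_congr μ l h]⟩
  · exact ⟨p + q - 1 - c, by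
      rw [windowSum_congr μ l h, windowSum_neg μ l hb.add_lt_mul hb.lt, Int.natAbs_neg]⟩

theorem coeffSet_height_unitaryCyclotomic_of_lt {p q r s : ℕ}
    (hp : IsPrimePow p) (hq : IsPrimePow q) (hr : IsPrimePow r) (hs : IsPrimePow s)
    (hp3 : 3 ≤ p) (hlt : p < q)
    (hpq : Nat.Coprime p q) (hpr : Nat.Coprime p r) (hps : Nat.Coprime p s)
    (hqr : Nat.Coprime q r) (hqs : Nat.Coprime q s) :
    IsConsecutiveString (coeffSet (unitaryCyclotomic (p * q * r))) ∧
    (q < r → q < s →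
      ((r : ℤ) ≡ (s : ℤ) [ZMOD ((p * q : ℕ) : ℤ)] →
        coeffSet (unitaryCyclotomic (p * q * r)) = coeffSet (unitaryCyclotomic (p * q * s))) ∧
      ((r : ℤ) ≡ -(s : ℤ) [ZMOD ((p * q : ℕ) : ℤ)] →
        coeffSet (unitaryCyclotomic (p * q * r)) = -coeffSet (unitaryCyclotomic (p * q * s)))) ∧
    (((r : ℤ) ≡ (s : ℤ) [ZMOD ((p * q : ℕ) : ℤ)] ∨
        (r : ℤ) ≡ -(s : ℤ) [ZMOD ((p * q : ℕ) : ℤ)]) →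
      q < r → s < q →
      height (unitaryCyclotomic (p * q * s)) ≤ height (unitaryCyclotomic (p * q * r)) ∧
      height (unitaryCyclotomic (p * q * r)) ≤ height (unitaryCyclotomic (p * q * s)) + 1) := by
  obtain ⟨μ, l, hb⟩ := exists_isBlockData hp3 hlt hpq
  have hfr := coeff_unitaryCyclotomic_eq hb hp hq hr hpr hqr
  have hfs := coeff_unitaryCyclotomic_eq hb hp hq hs hps hqs
  refine ⟨isConsecutiveString_coeffSet (abs_sub_le_one_of_eq_windowSum hb hpr hqr hfr),
    fun h1 h2 => ⟨fun h => ?_, fun h => ?_⟩, fun h h1 h2 => ⟨height_le fun n => ?_,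
      height_le fun n => ?_⟩⟩
  · rw [coeffSet_unitaryCyclotomic_eq hb hp hq hr hpr hqr h1,
      coeffSet_unitaryCyclotomic_eq hb hp hq hs hps hqs h2]
    simp only [windowSum_congr μ l h]
  · rw [coeffSet_unitaryCyclotomic_eq hb hp hq hr hpr hqr h1,
      coeffSet_unitaryCyclotomic_eq hb hp hq hs hps hqs h2]
    simp only [windowSum_congr μ l h, windowSum_neg μ l hb.add_lt_mul hlt]
    ext v
    simp only [Set.mem_ofPred_eq, Set.mem_neg]
    constructor
    · rintro ⟨k, c, rfl⟩
      exact ⟨k, _, (neg_neg _).symm⟩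
    · rintro ⟨k, c, hv⟩
      exact ⟨k, p + q - 1 - c, by rw [sub_sub_cancel, hv, neg_neg]⟩
  · have h' : (s : ℤ) ≡ r [ZMOD ((p * q : ℕ) : ℤ)] ∨ (s : ℤ) ≡ -r [ZMOD ((p * q : ℕ) : ℤ)] :=
      h.imp Int.ModEq.symm fun h => by simpa using h.neg.symm
    obtain ⟨c', hc'⟩ := natAbs_windowSum_eq_of_modEq hb h' (n / s + 1) n
    have hmem : windowSum p q μ l r (n / s + 1) c' ∈ coeffSet (unitaryCyclotomic (p * q * r)) := by
      rw [coeffSet_unitaryCyclotomic_eq hb hp hq hr hpr hqr h1]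
      exact ⟨_, _, rfl⟩
    obtain ⟨m, -, hm⟩ := hmem
    rw [hfs, hc', ← hm]
    exact natAbs_coeff_le_height _ _
  · obtain ⟨c', hc'⟩ := natAbs_windowSum_eq_of_modEq hb h (n / r + 1) n
    -- Only the height bound is asked of V, since 0 satisfies it even without being known to be a
    -- coefficient.
    obtain ⟨V, hV, hV'⟩ := exists_abs_windowSum_sub_le hb hs.pos h2
      (R := fun V => V.natAbs ≤ height (unitaryCyclotomic (p * q * s))) (by simp)
      (fun k c hk => by
        obtain ⟨m, hm⟩ := exists_coeff_eq_windowSum (Nat.mul_pos hp.pos hq.pos) hfs hk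
        rw [← hm]
        exact natAbs_coeff_le_height _ _) (n / r + 1) c'
    rw [hfr, hc']
    rw [abs_le] at hV'
    omega

theorem mainTheorem4 (p q r s : ℕ)
    (hp : IsPrimePow p) (hq : IsPrimePow q) (hr : IsPrimePow r) (hs : IsPrimePow s)
    (hp3 : 3 ≤ p) (hq3 : 3 ≤ q) (hr3 : 3 ≤ r) (hs3 : 3 ≤ s)
    (hpq : Nat.Coprime p q) (hpr : Nat.Coprime p r) (hps : Nat.Coprime p s)
    (hqr : Nat.Coprime q r) (hqs : Nat.Coprime q s) (hrs : Nat.Coprime r s) :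
    IsConsecutiveString (coeffSet (unitaryCyclotomic (p * q * r))) ∧
    (max p q < r → max p q < s →
      ((r : ℤ) ≡ (s : ℤ) [ZMOD ((p * q : ℕ) : ℤ)] →
        coeffSet (unitaryCyclotomic (p * q * r)) = coeffSet (unitaryCyclotomic (p * q * s))) ∧
      ((r : ℤ) ≡ -(s : ℤ) [ZMOD ((p * q : ℕ) : ℤ)] →
        coeffSet (unitaryCyclotomic (p * q * r)) = -coeffSet (unitaryCyclotomic (p * q * s)))) ∧
    (((r : ℤ) ≡ (s : ℤ) [ZMOD ((p * q : ℕ) : ℤ)] ∨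
        (r : ℤ) ≡ -(s : ℤ) [ZMOD ((p * q : ℕ) : ℤ)]) →
      max p q < r → s < max p q →
      height (unitaryCyclotomic (p * q * s)) ≤ height (unitaryCyclotomic (p * q * r)) ∧
      height (unitaryCyclotomic (p * q * r)) ≤ height (unitaryCyclotomic (p * q * s)) + 1) := by
  rcases lt_trichotomy p q with hlt | rfl | hlt
  · rw [max_eq_right hlt.le]
    exact coeffSet_height_unitaryCyclotomic_of_lt hp hq hr hs hp3 hlt hpq hpr hps hqr hqs
  · rw [Nat.coprime_self] at hpq
    omega
  · rw [max_eq_left hlt.le, mul_comm p q]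
    exact coeffSet_height_unitaryCyclotomic_of_lt hq hp hr hs hq3 hlt hpq.symm hqr hqs hpr hps
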